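/- **3.5 Spectral Gap Proposition.** Notation. Let $\mathfrak D=\{z\in\mathbb C:|z|<1\}$, $\mathbb T=\mathbb R/\mathbb Z$, let $m$ be the Lebesgue probability measure on $\mathbb T$, and $\chi(x)=e^{2\pi i x}$. An *inner function* is an analytic map $\phi:\mathfrak D\to\mathfrak D$ such that for $m$-a.e. $x\in\mathbb T$ the radial limit $\phi(\chi(x)):=\lim_{r\to1-}\phi(r\chi(x))$ exists and has modulus $1$. Its *restriction* $\tau=\tau(\phi):\mathbb T\to\mathbb T$ is the map, defined $m$-a.e., with $\chi(\tau x)=\phi(\chi(x))$. The *transfer operator* $\widehat\tau:L^1(m)\to L^1(m)$ is defined by $\int_A\widehat\tau f\,dm=\int_{\tau^{-1}A}f\,dm$ for all Borel $A\subseteq\mathbb T$. For $b>1$ let $$k_b=\Big\{u\in L^2(m):\ \|u\|_{k_b}^2:=\sum_{n\in\mathbb Z}b^{|n|}\,|\widehat u(n)|^2<\infty\Big\},\qquad \mathbb E(u):=\int_{\mathbb T}u\,dm=\widehat u(0).$$ Let $\phi$ be an inner function with $\phi(0)=0$ that is not a Möbius transformation, and let $\tau=\tau(\phi)$. (i) For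 every $b>1$ and every $\rho$ with $|\phi'(0)|<\rho<1$ there is $M>0$ such that for all $u\in k_b$ and all integers $N\ge0$, $\widehat\tau^N u-\mathbb E(u)\in k_b$ and $$\|\widehat\tau^N u-\mathbb E(u)\|_{k_b}\le M\rho^N\|u\|_{k_b}.$$ (ii) Suppose that $\phi(z)=z^\kappa\Phi(z)$ on $\mathfrak D$, where $\kappa\ge1$ is an integer and $\Phi$ is an inner function or a constant of modulus $1$. Then for every $b>1$, all $u\in k_b$ and all integers $N\ge0$, $\widehat\tau^N u-\mathbb E(u)\in k_b$ and $$\|\widehat\tau^N u-\mathbb E(u)\|_{k_b}\le\frac{b}{\sqrt{b-1}}\cdot\frac{1}{b^{\kappa^N/2}}\,\|u\|_{k_b}.$$ -/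

import Mathlib

open MeasureTheory Filter Topology

noncomputable section

namespace InnerFunction

/-- The circle `ℝ / ℤ`. -/
abbrev Torus : Type := UnitAddCircle

/-- Normalized Lebesgue (Haar) measure on the circle. -/
abbrev leb : Measure Torus := AddCircle.haarAddCircle

/-- The character `χ(x) = exp(2πix)`. -/
def chi (x : Torus) : ℂ := (AddCircle.toCircle x : ℂ)

/-- The open unit disc. -/
abbrev disc : Set ℂ := Metric.ball 0 1

/-- `φ` has the radial limit `w` at the boundary point `χ(x)`. -/
def HasRadialLimit (φ : ℂ → ℂ) (x : Torus) (w : ℂ) : Prop :=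
  Tendsto (fun r : ℝ => φ ((r : ℂ) * chi x)) (𝓝[<] (1 : ℝ)) (𝓝 w)

/-- Inner functions: analytic self-maps of the unit disc having unimodular radial limits at almost
every boundary point. Only the values of `φ` on the disc matter. -/
structure IsInner (φ : ℂ → ℂ) : Prop where
  analytic : AnalyticOnNhd ℂ φ disc
  mapsTo : Set.MapsTo φ disc disc
  radial : ∀ᵐ x ∂leb, ∃ w : ℂ, ‖w‖ = 1 ∧ HasRadialLimit φ x w

/-- `φ` agrees on the unit disc with a Möbius transformation. -/
def IsMobius (φ : ℂ → ℂ) : Prop :=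
  ∃ a b c d : ℂ, a * d - b * c ≠ 0 ∧
    ∀ z ∈ disc, c * z + d ≠ 0 ∧ φ z = (a * z + b) / (c * z + d)

/-- The boundary function `φ(χ(x)) = lim_{r → 1-} φ(rχ(x))` (meaningful where the limit exists). -/
def boundaryValue (φ : ℂ → ℂ) (x : Torus) : ℂ :=
  limUnder (𝓝[<] (1 : ℝ)) (fun r : ℝ => φ ((r : ℂ) * chi x))

/-- The restriction `τ` of `φ` to the circle: `χ(τ x) = φ(χ(x))` wherever the radial limit exists
and is unimodular; see `chi_restriction`. -/
def restriction (φ : ℂ → ℂ) (x : Torus) : Torus :=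
  ((Complex.arg (boundaryValue φ x) / (2 * Real.pi) : ℝ) : Torus)

theorem chi_restriction {φ : ℂ → ℂ} {x : Torus} {w : ℂ} (hw : ‖w‖ = 1)
    (h : HasRadialLimit φ x w) : chi (restriction φ x) = w := by
  have hb : boundaryValue φ x = w := h.limUnder_eq
  have h2 : (2 : ℂ) * Real.pi ≠ 0 := by
    simp [Real.pi_ne_zero]
  rw [restriction, hb, chi, AddCircle.toCircle_apply_mk, Circle.coe_exp]
  have : (((2 * Real.pi / 1 * (w.arg / (2 * Real.pi)) : ℝ) : ℂ)) = w.arg := by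
    push_cast
    field_simp
  rw [this]
  simpa [hw] using Complex.norm_mul_exp_arg_mul_I w

/-- The transfer operator on `L¹(μ)` of a nonsingular transformation `T`: `transferOp μ T f` is the
element `g` of `L¹(μ)`, unique if it exists (and it does for nonsingular `T`), such that
`∫_A g dμ = ∫_{T⁻¹A} f dμ` for all measurable `A`. -/
def transferOp {X : Type*} [MeasurableSpace X] (μ : Measure X) (T : X → X)
    (f : Lp ℂ 1 μ) : Lp ℂ 1 μ :=
  Classical.epsilon fun g : Lp ℂ 1 μ =>
    ∀ A : Set X, MeasurableSet A → ∫ x in A, g x ∂μ = ∫ x in T ⁻¹' A, f x ∂μ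

/-- The space `k_b` of `u ∈ L²` with `∑_{n ∈ ℤ} b^{|n|} |û(n)|² < ∞`. -/
def expSpace (b : ℝ) : Set (Torus → ℂ) :=
  {u | MemLp u 2 leb ∧ Summable fun n : ℤ => b ^ n.natAbs * ‖fourierCoeff u n‖ ^ 2}

/-- The norm of `k_b`. -/
def expNorm (b : ℝ) (u : Torus → ℂ) : ℝ :=
  Real.sqrt (∑' n : ℤ, b ^ n.natAbs * ‖fourierCoeff u n‖ ^ 2)

/-- The function `τ̂ᴺ u - 𝔼(u)` on the circle, where `τ` is the restriction of `φ`. -/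
def deviation (φ : ℂ → ℂ) (N : ℕ) (u : Lp ℂ 1 leb) : Torus → ℂ :=
  fun x => ((transferOp leb (restriction φ))^[N] u : Lp ℂ 1 leb) x - ∫ t, u t ∂leb

end InnerFunction

end

noncomputable section

namespace InnerFunction

/-! The transfer operator is the adjoint of composition with τ, so the moments of g against `chi x ^
n`, n ≥ 0, become after one step the moments of g against `boundaryValue φ x ^ n`. For mean-zero g
in k_b, these moments and those of the conjugate of g together give all Fourier coefficients, so it
suffices to control nonnegative moments.

Put r = b^(-1/2). A sequence of moments c with ∑ b^k |c k|² finite is represented on the smaller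
circle: there is G in L² with c n = ∫ (rχ)^n G and ‖G‖² equal to that sum. Boundary integrals of
bounded analytic functions against g then equal integrals over the circle of radius r against G,
where iteration of φ is ordinary composition. The moments at time N are therefore ∫ φ^[N](rχ)^n G.

Littlewood's subordination principle, sharpened by the bound |φ^[N]| ≤ s on |z| ≤ r and dualized,
shows that the weighted ℓ² norm shrinks by the factor s√b. It remains to estimate s. For (i),
Schwarz's lemma is strict because φ is not a rotation, so iterates reach a neighbourhood of 0 where
φ contracts at rate ρ; for (ii), |φ(z)| ≤ |z|^κ gives s = r^(κ^N). -/

/-! ### Analytic functions integrated over circles -/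

theorem norm_chi (x : Torus) : ‖chi x‖ = 1 := Circle.norm_coe _

theorem continuous_chi : Continuous chi :=
  continuous_subtype_val.comp AddCircle.continuous_toCircle

theorem chi_pow (x : Torus) (n : ℕ) : chi x ^ n = fourier (n : ℤ) x := by
  simp [chi, fourier_apply, AddCircle.toCircle_nsmul]

/-- Functions analytic on the disc are uniform limits of polynomials on smaller discs. -/
theorem exists_tendstoUniformlyOn_sum {h : ℂ → ℂ} (hh : AnalyticOnNhd ℂ h disc) {R : ℝ}
    (hR0 : 0 ≤ R) (hR : R < 1) :
    ∃ c : ℕ → ℂ, TendstoUniformlyOn (fun (n : ℕ) z => ∑ i ∈ Finset.range n, c i * z ^ i) h atTop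
      (Metric.closedBall 0 R) := by
  -- The Cauchy series on radius R'' converges uniformly only on strictly smaller balls, and R'
  -- gives an open ball that still contains the closed ball of radius R.
  obtain ⟨R', hRR', hR'⟩ := exists_between hR
  obtain ⟨R'', hRR'', hR''⟩ := exists_between hR'
  have hd : DifferentiableOn ℂ h (Metric.closedBall 0 R'') := fun z hz =>
    (hh z (Metric.closedBall_subset_ball hR'' hz)).differentiableAt.differentiableWithinAt
  lift R'' to NNReal using by linarith
  lift R' to NNReal using by linarith
  have := hd.hasFPowerSeriesOnBall (lt_of_le_of_lt (by positivity) hRR'')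
  refine ⟨fun n => (cauchyPowerSeries h 0 R'').coeff n, ?_⟩
  have h2 := (this.tendstoUniformlyOn' (r' := R') (by exact_mod_cast hRR'')).mono
    (s' := Metric.closedBall 0 R) (Metric.closedBall_subset_ball hRR')
  refine h2.congr (Eventually.of_forall fun n z hz => ?_)
  simp [FormalMultilinearSeries.partialSum, mul_comm]

/-- Two complex densities along two functions with the same moments give the same integrals for
every analytic function. -/
theorem integral_analytic_mul_eq_of_moments {h : ℂ → ℂ} (hh : AnalyticOnNhd ℂ h disc) {R : ℝ}
    (hR0 : 0 ≤ R) (hR : R < 1) {a a' g g' : Torus → ℂ}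
    (ha : Continuous a) (ha' : Continuous a') (haR : ∀ x, ‖a x‖ ≤ R) (haR' : ∀ x, ‖a' x‖ ≤ R)
    (hg : Integrable g leb) (hg' : Integrable g' leb)
    (hm : ∀ n : ℕ, ∫ x, a x ^ n * g x ∂leb = ∫ x, a' x ^ n * g' x ∂leb) :
    ∫ x, h (a x) * g x ∂leb = ∫ x, h (a' x) * g' x ∂leb := by
  obtain ⟨c, hc⟩ := exists_tendstoUniformlyOn_sum hh hR0 hR
  have key : ∀ {a g : Torus → ℂ}, Continuous a → (∀ x, ‖a x‖ ≤ R) → Integrable g leb →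
      Tendsto (fun n => ∫ x, (∑ i ∈ Finset.range n, c i * a x ^ i) * g x ∂leb) atTop
        (𝓝 (∫ x, h (a x) * g x ∂leb)) := by
    intro a g ha haR hg
    have hmem : ∀ x, a x ∈ Metric.closedBall (0 : ℂ) R := fun x => by simpa using haR x
    have hcont : ContinuousOn h (Metric.closedBall 0 R) := fun z hz =>
      (hh z (Metric.closedBall_subset_ball hR hz)).continuousAt.continuousWithinAt
    obtain ⟨C, hC⟩ := (isCompact_closedBall (0 : ℂ) R).exists_bound_of_continuousOn hcont
    -- Here |h| ≤ C on the closed ball, and the partial sums are eventually within 1 of h.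
    refine tendsto_integral_filter_of_dominated_convergence (fun x => (C + 1) * ‖g x‖) ?_ ?_
      (hg.norm.const_mul _) ?_
    · refine Eventually.of_forall fun n => ?_
      refine AEStronglyMeasurable.mul ?_ hg.1
      exact Continuous.aestronglyMeasurable (by fun_prop)
    · filter_upwards [Metric.tendstoUniformlyOn_iff.1 hc 1 one_pos] with n hn
      refine ae_of_all _ fun x => ?_
      rw [norm_mul]
      gcongr
      have h1 := hn _ (hmem x)
      have h2 := hC _ (hmem x)
      rw [dist_comm, dist_eq_norm] at h1
      have h3 := norm_sub_norm_le (∑ i ∈ Finset.range n, c i * a x ^ i) (h (a x))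
      linarith
    · exact ae_of_all _ fun x => (hc.tendsto_at (hmem x)).mul_const _
  refine tendsto_nhds_unique (key ha haR hg) ((key ha' haR' hg').congr fun n => ?_)
  have aux : ∀ {a g : Torus → ℂ}, Continuous a → (∀ x, ‖a x‖ ≤ R) → Integrable g leb →
      ∫ x, (∑ i ∈ Finset.range n, c i * a x ^ i) * g x ∂leb =
        ∑ i ∈ Finset.range n, c i * ∫ x, a x ^ i * g x ∂leb := by
    intro a g ha haR hg
    simp_rw [Finset.sum_mul, mul_assoc]
    rw [integral_finsetSum]
    · simp_rw [integral_const_mul]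
    · intro i _
      refine Integrable.const_mul ?_ _
      refine hg.bdd_mul (c := R ^ i) (ha.pow i).aestronglyMeasurable (ae_of_all _ fun x => ?_)
      rw [norm_pow]
      exact pow_le_pow_left₀ (norm_nonneg _) (haR x) i
  rw [aux ha haR hg, aux ha' haR' hg']
  simp_rw [hm]

theorem integral_chi_pow (n : ℕ) : ∫ x, chi x ^ n ∂leb = if n = 0 then 1 else 0 := by
  have := fourierCoeff_fourier (T := 1) (n : ℤ)
  have h2 := congrFun this 0
  simp only [fourierCoeff, neg_zero, fourier_zero, one_smul] at h2
  simp_rw [chi_pow]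
  rw [h2]
  by_cases hn : n = 0 <;> simp [hn, eq_comm]

theorem norm_ofReal_mul_chi {r : ℝ} (hr : 0 ≤ r) (x : Torus) : ‖(r : ℂ) * chi x‖ = r := by
  rw [norm_mul, norm_chi, mul_one, Complex.norm_real, Real.norm_of_nonneg hr]

/-- The mean value property. -/
theorem integral_circle_eq {h : ℂ → ℂ} (hh : AnalyticOnNhd ℂ h disc) {r : ℝ}
    (hr0 : 0 ≤ r) (hr : r < 1) : ∫ x, h (r * chi x) ∂leb = h 0 := by
  have := integral_analytic_mul_eq_of_moments hh hr0 hr (a := fun x => r * chi x)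
    (a' := fun _ => 0) (g := fun _ => 1) (g' := fun _ => 1)
    (by have := continuous_chi; fun_prop) continuous_const (fun x => (norm_ofReal_mul_chi hr0 x).le)
    (by simpa using hr0) (integrable_const _) (integrable_const _) (fun n => by
      simp_rw [mul_pow, mul_one]
      rw [integral_const_mul, integral_chi_pow]
      by_cases hn : n = 0 <;> simp [hn])
  simpa using this

theorem continuous_circle {h : ℂ → ℂ} (hh : AnalyticOnNhd ℂ h disc) {r : ℝ}
    (hr0 : 0 ≤ r) (hr : r < 1) : Continuous fun x => h (r * chi x) := by
  have hc := continuous_chi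
  refine hh.continuousOn.comp_continuous (by fun_prop) fun x => ?_
  simpa [norm_chi, abs_of_nonneg hr0] using hr

/-! ### Littlewood subordination -/

/-- Littlewood's subordination principle for polynomials. -/
theorem integral_norm_sq_sum_le {φ : ℂ → ℂ} (hφ : AnalyticOnNhd ℂ φ disc) (h0 : φ 0 = 0)
    {r s : ℝ} (hr0 : 0 ≤ r) (hr : r < 1) (hs : ∀ x, ‖φ (r * chi x)‖ ≤ s) (n : ℕ) (c : ℕ → ℂ) :
    ∫ x, ‖∑ i ∈ Finset.range n, c i * φ (r * chi x) ^ i‖ ^ 2 ∂leb ≤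
      ∑ i ∈ Finset.range n, s ^ (2 * i) * ‖c i‖ ^ 2 := by
  have hcont := continuous_circle hφ hr0 hr
  have hcompact : ∀ {f : Torus → ℝ}, Continuous f → Integrable f leb := fun hf =>
    hf.integrable_of_hasCompactSupport (HasCompactSupport.of_compactSpace _)
  have hcompact' : ∀ {f : Torus → ℂ}, Continuous f → Integrable f leb := fun hf =>
    hf.integrable_of_hasCompactSupport (HasCompactSupport.of_compactSpace _)
  have hs0 : 0 ≤ s := (norm_nonneg _).trans (hs 0)
  induction n generalizing c with
  | zero => simp
  | succ n ih =>
    -- Split the polynomial as c 0 + w q(w) with w = φ(rχ). The cross term has mean zero, since z ↦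
    -- φ(z) q(φ(z)) vanishes at 0; the square of the second part costs s², and induction applies to
    -- q.
    set q : ℂ → ℂ := fun z => ∑ i ∈ Finset.range n, c (i + 1) * z ^ i with hq
    have hqc : Continuous fun x => q (φ (r * chi x)) := 
      continuous_finsetSum _ fun i _ => continuous_const.mul (hcont.pow i)
    have hpc : Continuous fun x => (starRingEnd ℂ (c 0)) * (φ (r * chi x) * q (φ (r * chi x))) :=
      continuous_const.mul (hcont.mul hqc)
    have hrc : Continuous fun x =>
        2 * ((starRingEnd ℂ (c 0)) * (φ (r * chi x) * q (φ (r * chi x)))).re :=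
      (Complex.continuous_re.comp hpc).const_mul 2
    have hcc : Continuous fun x => ‖c 0‖ ^ 2 +
        2 * ((starRingEnd ℂ (c 0)) * (φ (r * chi x) * q (φ (r * chi x)))).re :=
      continuous_const.add hrc
    have hsc : Continuous fun x => ‖φ (r * chi x)‖ ^ 2 * ‖q (φ (r * chi x))‖ ^ 2 :=
      (hcont.norm.pow 2).mul (hqc.norm.pow 2)
    have hA : AnalyticOnNhd ℂ (fun z => φ z * q (φ z)) disc := by
      intro z hz
      have hz' := hφ z hz
      simp only [hq]
      refine hz'.mul (Finset.analyticAt_fun_sum _ fun i _ => ?_)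
      exact analyticAt_const.mul (hz'.pow i)
    have hmean := integral_circle_eq hA hr0 hr
    simp only [h0, zero_mul] at hmean
    have hexp : ∀ x, ‖∑ i ∈ Finset.range (n + 1), c i * φ (r * chi x) ^ i‖ ^ 2 =
        ‖c 0‖ ^ 2 + 2 * ((starRingEnd ℂ (c 0)) * (φ (r * chi x) * q (φ (r * chi x)))).re +
          ‖φ (r * chi x)‖ ^ 2 * ‖q (φ (r * chi x))‖ ^ 2 := by
      intro x
      have : ∑ i ∈ Finset.range (n + 1), c i * φ (r * chi x) ^ i =
          c 0 + φ (r * chi x) * q (φ (r * chi x)) := by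
        rw [Finset.sum_range_succ', add_comm, hq]
        simp only [pow_zero, mul_one, Finset.mul_sum]
        congr 1
        exact Finset.sum_congr rfl fun i _ => by ring
      rw [this, ← mul_pow, ← norm_mul, ← Complex.normSq_eq_norm_sq, ← Complex.normSq_eq_norm_sq,
        ← Complex.normSq_eq_norm_sq, Complex.normSq_add]
      have : (c 0 * (starRingEnd ℂ) (φ (r * chi x) * q (φ (r * chi x)))).re =
          ((starRingEnd ℂ (c 0)) * (φ (r * chi x) * q (φ (r * chi x)))).re := by
        rw [← Complex.conj_re]
        simp
      rw [this]
      ring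
    simp_rw [hexp]
    rw [integral_add (hcompact hcc) (hcompact hsc),
      integral_add (hcompact continuous_const) (hcompact hrc), integral_const_mul]
    have hre : ∫ x, ((starRingEnd ℂ (c 0)) * (φ (r * chi x) * q (φ (r * chi x)))).re ∂leb = 0 := by
      have := integral_re (𝕜 := ℂ) (μ := leb)
        (hcompact' (f := fun x => (starRingEnd ℂ (c 0)) * (φ (r * chi x) * q (φ (r * chi x))))
          hpc)
      simp only [RCLike.re_to_complex] at this
      rw [this, integral_const_mul, hmean]
      simp
    rw [hre, Finset.sum_range_succ']
    have hle : ∫ x, ‖φ (r * chi x)‖ ^ 2 * ‖q (φ (r * chi x))‖ ^ 2 ∂leb ≤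
        s ^ 2 * ∑ i ∈ Finset.range n, s ^ (2 * i) * ‖c (i + 1)‖ ^ 2 := by
      calc _ ≤ ∫ x, s ^ 2 * ‖q (φ (r * chi x))‖ ^ 2 ∂leb := by
            refine integral_mono (hcompact hsc)
              (hcompact ((hqc.norm.pow 2).const_mul _)) fun x => ?_
            have := hs x
            dsimp only
            gcongr
        _ ≤ _ := by
            rw [integral_const_mul]
            gcongr
            exact ih fun i => c (i + 1)
    have hsum : ∑ i ∈ Finset.range n, s ^ (2 * (i + 1)) * ‖c (i + 1)‖ ^ 2 =
        s ^ 2 * ∑ i ∈ Finset.range n, s ^ (2 * i) * ‖c (i + 1)‖ ^ 2 := by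
      rw [Finset.mul_sum]
      exact Finset.sum_congr rfl fun i _ => by ring
    rw [hsum]
    simp
    linarith

/-! ### Moving moments to a smaller circle -/

theorem exists_memLp_fourierCoeff_eq {e : ℤ → ℂ} (he : Summable fun n => ‖e n‖ ^ 2) :
    ∃ G : Torus → ℂ, MemLp G 2 leb ∧ fourierCoeff G = e ∧ ∫ x, ‖G x‖ ^ 2 ∂leb = ∑' n, ‖e n‖ ^ 2 := by
  have hmem : Memℓp e 2 := by
    rw [memℓp_gen_iff (by norm_num)]
    simpa using he
  set G := (fourierBasis (T := 1)).repr.symm ⟨e, hmem⟩ with hG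
  have hc : ∀ n, fourierCoeff G n = e n := fun n => by
    rw [← fourierBasis_repr, hG, LinearIsometryEquiv.apply_symm_apply]
  refine ⟨G, Lp.memLp G, funext hc, ?_⟩
  rw [← tsum_sq_fourierCoeff]
  simp_rw [hc]

theorem integral_circle_pow_mul (r : ℝ) (n : ℕ) (G : Torus → ℂ) :
    ∫ x, (r * chi x) ^ n * G x ∂leb = r ^ n * ∫ x, chi x ^ n * G x ∂leb := by
  simp_rw [mul_pow, mul_assoc]
  rw [integral_const_mul]

theorem integral_chi_pow_mul (n : ℕ) (G : Torus → ℂ) :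
    ∫ x, chi x ^ n * G x ∂leb = fourierCoeff G (-n) := by
  simp [fourierCoeff, chi_pow, -fourier_apply]

/-- Passing to radius b^(-1/2) divides the n-th moment by b^(n/2), so the weight b^n is absorbed
into the L² norm of G. This turns the k_b norm into a plain L² norm by Riesz–Fischer and Parseval.
-/
theorem exists_memLp_integral_pow_mul_eq {b : ℝ} (hb : 1 < b) {c : ℕ → ℂ}
    (hc : Summable fun k => b ^ k * ‖c k‖ ^ 2) :
    ∃ G : Torus → ℂ, MemLp G 2 leb ∧
      (∀ n : ℕ, ∫ x, (((Real.sqrt b)⁻¹ : ℝ) * chi x) ^ n * G x ∂leb = c n) ∧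
      ∫ x, ‖G x‖ ^ 2 ∂leb = ∑' k, b ^ k * ‖c k‖ ^ 2 := by
  have hb0 : 0 < Real.sqrt b := Real.sqrt_pos.2 (by linarith)
  -- Pairing with `chi x ^ n` picks out the coefficient at -n, hence the support on m ≤ 0.
  set e : ℤ → ℂ := fun m => if m ≤ 0 then (Real.sqrt b : ℂ) ^ m.natAbs * c m.natAbs else 0 with he
  have hinj : Function.Injective fun k : ℕ => -(k : ℤ) := fun i j h => by simpa using h
  have hek : ∀ k : ℕ, e (-(k : ℤ)) = (Real.sqrt b : ℂ) ^ k * c k := fun k => by simp [he]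
  have hek2 : ∀ k : ℕ, ‖e (-(k : ℤ))‖ ^ 2 = b ^ k * ‖c k‖ ^ 2 := fun k => by
    rw [hek, norm_mul, norm_pow, Complex.norm_real, Real.norm_of_nonneg hb0.le, mul_pow, ← pow_mul,
      mul_comm k, pow_mul, Real.sq_sqrt (by linarith)]
  have hsupp : ∀ m ∉ Set.range (fun k : ℕ => -(k : ℤ)), ‖e m‖ ^ 2 = 0 := fun m hm => by
    have : ¬ m ≤ 0 := fun h => hm ⟨m.natAbs, by dsimp only; omega⟩
    simp [he, this]
  have hsum : HasSum (fun n => ‖e n‖ ^ 2) (∑' k, b ^ k * ‖c k‖ ^ 2) := by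
    rw [← hinj.hasSum_iff hsupp]
    refine hc.hasSum.congr_fun ?_
    intro k; exact hek2 k
  obtain ⟨G, hG, hGe, hGn⟩ := exists_memLp_fourierCoeff_eq hsum.summable
  refine ⟨G, hG, fun n => ?_, by rw [hGn, hsum.tsum_eq]⟩
  rw [integral_circle_pow_mul, integral_chi_pow_mul, hGe, hek]
  have : (Real.sqrt b : ℂ) ≠ 0 := by exact_mod_cast hb0.ne'
  push_cast
  rw [← mul_assoc, ← mul_pow, inv_mul_cancel₀ this, one_pow, one_mul]

/-- The boundary integral of a bounded analytic function against `g` can be moved to a smaller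
circle. -/
theorem integral_boundary_mul_eq {h : ℂ → ℂ} (hh : AnalyticOnNhd ℂ h disc) {C : ℝ}
    (hC : ∀ z ∈ disc, ‖h z‖ ≤ C) {H : Torus → ℂ} (hH : ∀ᵐ x ∂leb, HasRadialLimit h x (H x))
    {r : ℝ} (hr0 : 0 ≤ r) (hr : r < 1) {g G : Torus → ℂ} (hg : Integrable g leb)
    (hG : Integrable G leb)
    (hm : ∀ n : ℕ, ∫ x, chi x ^ n * g x ∂leb = ∫ x, (r * chi x) ^ n * G x ∂leb) :
    ∫ x, H x * g x ∂leb = ∫ x, h (r * chi x) * G x ∂leb := by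
  have hchi := continuous_chi
  have hmem : ∀ᶠ R : ℝ in 𝓝[<] (1 : ℝ), 0 < R ∧ R < 1 := by
    filter_upwards [Ioo_mem_nhdsLT (zero_lt_one' ℝ)] with R hR using hR
  -- The Taylor series of h need not converge on the boundary, so both sides are first compared for
  -- the dilation h(R ·) with R < 1, and then R → 1 by dominated convergence.
  have h1 : Tendsto (fun R : ℝ => ∫ x, h (R * chi x) * g x ∂leb) (𝓝[<] (1 : ℝ))
      (𝓝 (∫ x, H x * g x ∂leb)) := by
    refine tendsto_integral_filter_of_dominated_convergence (fun x => C * ‖g x‖) ?_ ?_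
      (hg.norm.const_mul _) ?_
    · filter_upwards [hmem] with R hR
      exact (continuous_circle hh hR.1.le hR.2).aestronglyMeasurable.mul hg.1
    · filter_upwards [hmem] with R hR
      refine ae_of_all _ fun x => ?_
      rw [norm_mul]
      gcongr
      exact hC _ (by simpa [norm_chi, abs_of_pos hR.1] using hR.2)
    · filter_upwards [hH] with x hx using hx.mul_const _
  have h2 : Tendsto (fun R : ℝ => ∫ x, h (R * (r * chi x)) * G x ∂leb) (𝓝[<] (1 : ℝ))
      (𝓝 (∫ x, h (r * chi x) * G x ∂leb)) := by
    refine tendsto_integral_filter_of_dominated_convergence (fun x => C * ‖G x‖) ?_ ?_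
      (hG.norm.const_mul _) ?_
    · filter_upwards [hmem] with R hR
      have := continuous_circle hh (mul_nonneg hR.1.le hr0) (by nlinarith [hR.1, hR.2])
      simp only [Complex.ofReal_mul, mul_assoc] at this
      exact this.aestronglyMeasurable.mul hG.1
    · filter_upwards [hmem] with R hR
      refine ae_of_all _ fun x => ?_
      rw [norm_mul]
      gcongr
      refine hC _ ?_
      simp only [Metric.mem_ball, dist_zero_right, norm_mul, Complex.norm_real, norm_chi, mul_one,
        Real.norm_of_nonneg hr0, Real.norm_of_nonneg hR.1.le]
      nlinarith [hR.1, hR.2]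
    · refine ae_of_all _ fun x => Tendsto.mul_const _ ?_
      have hz : (r : ℂ) * chi x ∈ disc := by simpa [norm_chi, abs_of_nonneg hr0] using hr
      have hc : Tendsto (fun R : ℝ => (R : ℂ) * (r * chi x)) (𝓝[<] (1 : ℝ)) (𝓝 (r * chi x)) := by
        have : Continuous fun R : ℝ => (R : ℂ) * (r * chi x) := by fun_prop
        simpa using (this.tendsto 1).mono_left nhdsWithin_le_nhds
      exact (hh _ hz).continuousAt.tendsto.comp hc
  refine tendsto_nhds_unique h1 (h2.congr' ?_)
  filter_upwards [hmem] with R hR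
  symm
  refine integral_analytic_mul_eq_of_moments hh hR.1.le hR.2 (by fun_prop) (by fun_prop)
    (fun x => (norm_ofReal_mul_chi hR.1.le x).le) (fun x => ?_) hg hG fun n => ?_
  · rw [norm_mul, norm_ofReal_mul_chi hr0, Complex.norm_real, Real.norm_of_nonneg hR.1.le]
    nlinarith [hR.1, hR.2]
  · rw [integral_circle_pow_mul, hm]
    simp_rw [mul_pow (R : ℂ), mul_assoc]
    rw [integral_const_mul]

theorem norm_integral_mul_sq_le {f g : Torus → ℂ} (hf : MemLp f 2 leb) (hg : MemLp g 2 leb) :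
    ‖∫ x, f x * g x ∂leb‖ ^ 2 ≤ (∫ x, ‖f x‖ ^ 2 ∂leb) * ∫ x, ‖g x‖ ^ 2 ∂leb := by
  have h1 := integral_mul_norm_le_Lp_mul_Lq (μ := leb) (f := f) (g := g)
    (p := 2) (q := 2) (by exact Real.HolderConjugate.two_two) (by simpa using hf) (by simpa using hg)
  have h2 : ‖∫ x, f x * g x ∂leb‖ ≤ ∫ x, ‖f x‖ * ‖g x‖ ∂leb := by
    simpa using norm_integral_le_integral_norm (μ := leb) fun x => f x * g x
  have h3 := h2.trans h1
  simp only [Real.rpow_two, ← Real.sqrt_eq_rpow] at h3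
  calc _ ≤ _ := pow_le_pow_left₀ (norm_nonneg _) h3 2
    _ = _ := by
      rw [mul_pow, Real.sq_sqrt (integral_nonneg fun _ => by positivity),
        Real.sq_sqrt (integral_nonneg fun _ => by positivity)]

/-! ### Decay of moments -/

/-- The dual form of Littlewood's principle. -/
theorem sum_norm_sq_integral_pow_mul_le {ψ : ℂ → ℂ} (hψ : AnalyticOnNhd ℂ ψ disc) (h0 : ψ 0 = 0)
    {b r s : ℝ} (hb : 0 < b) (hr0 : 0 ≤ r) (hr : r < 1) (hs : ∀ x, ‖ψ (r * chi x)‖ ≤ s)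
    (hsb : s ^ 2 * b ≤ 1) {G : Torus → ℂ} (hG : MemLp G 2 leb) {d : ℕ → ℂ}
    (hd : ∀ n, d n = ∫ x, ψ (r * chi x) ^ n * G x ∂leb) (hd0 : d 0 = 0) (K : ℕ) :
    ∑ n ∈ Finset.range K, b ^ n * ‖d n‖ ^ 2 ≤ s ^ 2 * b * ∫ x, ‖G x‖ ^ 2 ∂leb := by
  set S := ∑ n ∈ Finset.range K, b ^ n * ‖d n‖ ^ 2 with hS
  have hS0 : 0 ≤ S := by positivity
  -- The extremal test polynomial: pairing it with G returns S itself, so Cauchy–Schwarz followed by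
  -- Littlewood yields S² ≤ s² b S ‖G‖².
  set c : ℕ → ℂ := fun n => b ^ n * starRingEnd ℂ (d n) with hc
  have hcont := continuous_circle hψ hr0 hr
  have hfc : Continuous fun x => ∑ n ∈ Finset.range K, c n * ψ (r * chi x) ^ n :=
    continuous_finsetSum _ fun i _ => continuous_const.mul (hcont.pow i)
  have hf : MemLp (fun x => ∑ n ∈ Finset.range K, c n * ψ (r * chi x) ^ n) 2 leb :=
    hfc.memLp_of_hasCompactSupport (HasCompactSupport.of_compactSpace _)
  have hGi : Integrable G leb := hG.integrable (by norm_num)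
  have hSeq : (S : ℂ) = ∫ x, (∑ n ∈ Finset.range K, c n * ψ (r * chi x) ^ n) * G x ∂leb := by
    simp_rw [Finset.sum_mul, mul_assoc]
    rw [integral_finsetSum]
    · rw [hS]
      push_cast
      refine Finset.sum_congr rfl fun n _ => ?_
      rw [integral_const_mul, ← hd, hc]
      dsimp only
      rw [mul_assoc, Complex.conj_mul']
    · intro i _
      refine Integrable.const_mul ?_ _
      refine hGi.bdd_mul (c := s ^ i) (hcont.pow i).aestronglyMeasurable (ae_of_all _ fun x => ?_)
      rw [norm_pow]
      exact pow_le_pow_left₀ (norm_nonneg _) (hs x) i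
  have h1 := norm_integral_mul_sq_le hf hG
  rw [← hSeq, Complex.norm_real, Real.norm_of_nonneg hS0] at h1
  have h2 : ∫ x, ‖∑ n ∈ Finset.range K, c n * ψ (r * chi x) ^ n‖ ^ 2 ∂leb ≤ s ^ 2 * b * S := by
    refine (integral_norm_sq_sum_le hψ h0 hr0 hr hs K c).trans ?_
    rw [hS, Finset.mul_sum]
    refine Finset.sum_le_sum fun n _ => ?_
    have hcn : ‖c n‖ = b ^ n * ‖d n‖ := by
      simp [hc, abs_of_pos hb]
    -- The term n = 0 would carry no factor s², but d 0 = 0; each later term has (s² b)^(n+1), of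
    -- which one factor is kept.
    rcases n with _ | n
    · simp [hcn, hd0]
    · have : s ^ (2 * (n + 1)) * ‖c (n + 1)‖ ^ 2 =
          (s ^ 2 * b) ^ n * (s ^ 2 * b * (b ^ (n + 1) * ‖d (n + 1)‖ ^ 2)) := by
        rw [hcn]; ring
      rw [this]
      exact mul_le_of_le_one_left (by positivity) (pow_le_one₀ (by positivity) hsb)
  have hG0 : 0 ≤ ∫ x, ‖G x‖ ^ 2 ∂leb := integral_nonneg fun _ => by positivity
  rcases hS0.eq_or_lt with h | h
  · rw [← h]; positivity
  · have : S * S ≤ S * (s ^ 2 * b * ∫ x, ‖G x‖ ^ 2 ∂leb) := by nlinarith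
    exact le_of_mul_le_mul_left this h

theorem IsInner.norm_le {φ : ℂ → ℂ} (hφ : IsInner φ) (h0 : φ 0 = 0) {z : ℂ} (hz : z ∈ disc) :
    ‖φ z‖ ≤ ‖z‖ :=
  Complex.norm_le_norm_of_mapsTo_ball hφ.analytic.differentiableOn
    (hφ.mapsTo.mono_right Metric.ball_subset_closedBall) h0 (by simpa using hz)

theorem IsInner.hasRadialLimit {φ : ℂ → ℂ} (hφ : IsInner φ) :
    ∀ᵐ x ∂leb, HasRadialLimit φ x (boundaryValue φ x) := by
  filter_upwards [hφ.radial] with x ⟨w, _, hw⟩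
  have : boundaryValue φ x = w := hw.limUnder_eq
  rwa [this]

theorem IsInner.analytic_iterate {φ : ℂ → ℂ} (hφ : IsInner φ) (N : ℕ) :
    AnalyticOnNhd ℂ φ^[N] disc := by
  induction N with
  | zero => exact analyticOnNhd_id
  | succ N ih => exact ih.comp hφ.analytic hφ.mapsTo

/-- This converts one step of the moment recursion, which involves boundary values of φ, into an
integral inside the disc. -/
theorem IsInner.integral_boundaryValue_pow_mul_eq {φ : ℂ → ℂ} (hφ : IsInner φ)
    {r : ℝ} (hr0 : 0 ≤ r) (hr : r < 1) {g G : Torus → ℂ} (hg : Integrable g leb)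
    (hG : Integrable G leb)
    (hm : ∀ n : ℕ, ∫ x, chi x ^ n * g x ∂leb = ∫ x, (r * chi x) ^ n * G x ∂leb) (n : ℕ) :
    ∫ x, boundaryValue φ x ^ n * g x ∂leb = ∫ x, φ (r * chi x) ^ n * G x ∂leb := by
  refine integral_boundary_mul_eq (h := fun z => φ z ^ n) (hφ.analytic.pow n) (C := 1)
    (fun z hz => ?_) ?_ hr0 hr hg hG hm
  · have := hφ.mapsTo hz
    rw [norm_pow]
    exact pow_le_one₀ (norm_nonneg _) (by simpa using (mem_ball_zero_iff.1 this).le)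
  · filter_upwards [hφ.hasRadialLimit] with x hx using hx.pow n

/-- Decay of the nonnegative moments under iteration of the moment recursion given by an inner
function. -/
theorem IsInner.summable_and_tsum_moments_le {φ : ℂ → ℂ} (hφ : IsInner φ) (h0 : φ 0 = 0) {b : ℝ}
    (hb : 1 < b) {g : ℕ → Torus → ℂ} (hg : ∀ N, MemLp (g N) 2 leb) (hg0 : ∀ N, ∫ x, g N x ∂leb = 0)
    (hstep : ∀ N n : ℕ,
      ∫ x, chi x ^ n * g (N + 1) x ∂leb = ∫ x, boundaryValue φ x ^ n * g N x ∂leb)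
    (hsum : Summable fun k : ℕ => b ^ k * ‖∫ x, chi x ^ k * g 0 x ∂leb‖ ^ 2) (N : ℕ) {s : ℝ}
    (hs : ∀ z : ℂ, ‖z‖ ≤ (Real.sqrt b)⁻¹ → ‖φ^[N] z‖ ≤ s) (hsb : s ^ 2 * b ≤ 1) :
    Summable (fun k : ℕ => b ^ k * ‖∫ x, chi x ^ k * g N x ∂leb‖ ^ 2) ∧
      ∑' k : ℕ, b ^ k * ‖∫ x, chi x ^ k * g N x ∂leb‖ ^ 2 ≤
        s ^ 2 * b * ∑' k : ℕ, b ^ k * ‖∫ x, chi x ^ k * g 0 x ∂leb‖ ^ 2 := by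
  have hb0 : 0 < b := by linarith
  set r := (Real.sqrt b)⁻¹ with hrdef
  have hr0 : 0 ≤ r := by positivity
  have hr : r < 1 := inv_lt_one_of_one_lt₀ (by rw [Real.lt_sqrt zero_le_one]; simpa using hb)
  have hrb : r ^ 2 * b ≤ 1 := by
    rw [hrdef, inv_pow, Real.sq_sqrt hb0.le, inv_mul_cancel₀ hb0.ne']
  have hgi : ∀ N, Integrable (g N) leb := fun N => (hg N).integrable (by norm_num)
  have hrx : ∀ x, ‖(r : ℂ) * chi x‖ ≤ r := fun x => (norm_ofReal_mul_chi hr0 x).le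
  have hmem : ∀ {z : ℂ}, ‖z‖ ≤ r → z ∈ disc := fun hz => by simpa using hz.trans_lt hr
  have hφr : ∀ x, ‖φ (r * chi x)‖ ≤ r := fun x => (hφ.norm_le h0 (hmem (hrx x))).trans (hrx x)
  -- Representing `g N` by some G requires summable moments at time N. This is propagated one step
  -- at a time with s = r, which Schwarz's lemma allows and for which s² b = 1.
  have hsummable : ∀ N, Summable fun k : ℕ => b ^ k * ‖∫ x, chi x ^ k * g N x ∂leb‖ ^ 2 := by
    intro N
    induction N with
    | zero => exact hsum
    | succ N ih =>
      obtain ⟨G, hG, hGm, -⟩ := exists_memLp_integral_pow_mul_eq hb ih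
      refine summable_of_sum_range_le (fun _ => by positivity) fun K =>
        sum_norm_sq_integral_pow_mul_le hφ.analytic h0 hb0 hr0 hr hφr hrb hG (fun n => ?_) ?_ K
      · rw [hstep]
        exact hφ.integral_boundaryValue_pow_mul_eq hr0 hr (hgi N) (hG.integrable (by norm_num))
          (fun n => (hGm n).symm) n
      · simpa using hg0 (N + 1)
  refine ⟨hsummable N, ?_⟩
  choose G hG hGm hGn using fun N => exists_memLp_integral_pow_mul_eq hb (hsummable N)
  have hGi : ∀ N, Integrable (G N) leb := fun N => (hG N).integrable (by norm_num)
  have hchi := continuous_chi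
  -- Each step replaces h by h ∘ φ. Working with all analytic h inside the disc avoids any
  -- composition of boundary values; the sharp constant then comes from a single application of the
  -- dual bound to φ^[N].
  have hiter : ∀ N, ∀ h : ℂ → ℂ, AnalyticOnNhd ℂ h disc →
      ∫ x, h (r * chi x) * G N x ∂leb = ∫ x, h (φ^[N] (r * chi x)) * G 0 x ∂leb := by
    intro N
    induction N with
    | zero => intro h _; rfl
    | succ N ih =>
      intro h hh
      simp_rw [Function.iterate_succ_apply']
      rw [← ih (fun z => h (φ z)) (hh.comp hφ.analytic hφ.mapsTo)]
      refine integral_analytic_mul_eq_of_moments hh hr0 hr (by fun_prop)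
        (continuous_circle hφ.analytic hr0 hr) hrx hφr (hGi _) (hGi _) fun n => ?_
      rw [hGm, hstep]
      exact hφ.integral_boundaryValue_pow_mul_eq hr0 hr (hgi N) (hGi N) (fun n => (hGm N n).symm) n
  have hφN0 : φ^[N] 0 = 0 := Function.iterate_fixed h0 N
  rw [← hGn 0]
  refine Real.tsum_le_of_sum_range_le (fun _ => by positivity) fun K =>
    sum_norm_sq_integral_pow_mul_le (hφ.analytic_iterate N) hφN0 hb0 hr0 hr
      (fun x => hs _ (hrx x)) hsb (hG 0) (fun n => ?_) ?_ K
  · rw [← hGm N n, ← hiter N (fun z => z ^ n) (analyticOnNhd_id.pow n)]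
  · simpa using hg0 N

/-! ### Size of the iterates inside the disc -/

/-- Write φ(z) = z g(z) with g(0) = φ'(0). On |z| ≤ r one has |g| ≤ q < 1, so after finitely many
steps N₀, uniformly in z, the orbit lies where |g| < ρ. The constant C pays for those first steps.
-/
theorem IsInner.exists_norm_iterate_le {φ : ℂ → ℂ} (hφ : IsInner φ) (hmob : ¬ IsMobius φ)
    (h0 : φ 0 = 0) {ρ r : ℝ} (hρ : ‖deriv φ 0‖ < ρ) (hρ1 : ρ < 1) (hr0 : 0 ≤ r) (hr : r < 1) :
    ∃ C : ℝ, 0 < C ∧ ∀ (N : ℕ) (z : ℂ), ‖z‖ ≤ r → ‖φ^[N] z‖ ≤ C * ρ ^ N * r := by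
  have hρ0 : 0 < ρ := (norm_nonneg _).trans_lt hρ
  have h0mem : (0 : ℂ) ∈ disc := by simp
  set g := dslope φ 0 with hg
  have hgd : DifferentiableOn ℂ g disc :=
    (Complex.differentiableOn_dslope (Metric.isOpen_ball.mem_nhds h0mem)).2
      hφ.analytic.differentiableOn
  have hφg : ∀ z, φ z = z * g z := fun z => by
    simpa [h0] using (sub_smul_dslope φ 0 z).symm
  have hg1 : ∀ z ∈ disc, ‖g z‖ ≤ 1 := fun z hz => by
    have := Complex.norm_dslope_le_div_of_mapsTo_ball (R₂ := 1) hφ.analytic.differentiableOn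
      (by rw [h0]; exact hφ.mapsTo.mono_right Metric.ball_subset_closedBall) hz
    simpa using this
  have hglt : ∀ z ∈ disc, ‖g z‖ < 1 := by
    intro z hz
    -- If |g| attained 1, the maximum principle would make g constant and φ a rotation.
    refine (hg1 z hz).lt_of_ne fun hz1 => hmob ?_
    have hconst := Complex.eqOn_of_isPreconnected_of_isMaxOn_norm
      (convex_ball (0 : ℂ) 1).isPreconnected Metric.isOpen_ball hgd hz
      (fun w hw => by simpa [hz1] using hg1 w hw)
    refine ⟨g z, 0, 0, 1, ?_, fun w hw => ⟨by simp, ?_⟩⟩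
    · have : g z ≠ 0 := fun h => by simp [h] at hz1
      simpa using this
    · rw [hφg, hconst hw]
      simp [mul_comm]
  have hmem : ∀ {z : ℂ}, ‖z‖ ≤ r → z ∈ disc := fun hz => by simpa using hz.trans_lt hr
  obtain ⟨z₁, hz₁, hmax⟩ := (isCompact_closedBall (0 : ℂ) r).exists_isMaxOn
    ⟨0, by simpa using hr0⟩ (hgd.continuousOn.mono (Metric.closedBall_subset_ball hr)).norm
  set q := ‖g z₁‖ with hq
  have hq1 : q < 1 := hglt _ (hmem (by simpa using hz₁))
  have hgq : ∀ z : ℂ, ‖z‖ ≤ r → ‖g z‖ ≤ q := fun z hz => hmax (by simpa using hz)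
  have hg0 : g 0 = deriv φ 0 := dslope_same _ _
  have hcont : ContinuousAt (fun z => ‖g z‖) 0 :=
    (hgd.continuousOn.continuousAt (Metric.isOpen_ball.mem_nhds h0mem)).norm
  obtain ⟨δ, hδ, hgδ⟩ := Metric.eventually_nhds_iff.1
    (hcont.eventually_lt continuousAt_const (by simpa [hg0] using hρ) : ∀ᶠ z in 𝓝 0, ‖g z‖ < ρ)
  have hstep : ∀ (N : ℕ) (z : ℂ), ‖z‖ ≤ r → ‖φ^[N] z‖ ≤ q ^ N * r ∧ ‖φ^[N] z‖ ≤ r := by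
    intro N z hz
    induction N with
    | zero => simpa using hz
    | succ N ih =>
      rw [Function.iterate_succ_apply', hφg, norm_mul]
      have h1 := hgq _ ih.2
      have h2 := norm_nonneg (φ^[N] z)
      have h3 : ‖φ^[N] z‖ * ‖g (φ^[N] z)‖ ≤ (q ^ N * r) * q :=
        mul_le_mul ih.1 h1 (norm_nonneg _) (by positivity)
      refine ⟨h3.trans (le_of_eq (by ring)), ?_⟩
      exact (mul_le_of_le_one_right h2 (h1.trans hq1.le)).trans ih.2
  have hfast : ∀ (k : ℕ) (w : ℂ), ‖w‖ < δ → ‖w‖ ≤ r → ‖φ^[k] w‖ ≤ ρ ^ k * ‖w‖ := by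
    intro k w hw hwr
    induction k with
    | zero => simp
    | succ k ih =>
      have h1 : ‖φ^[k] w‖ < δ :=
        (ih.trans (mul_le_of_le_one_left (norm_nonneg _) (pow_le_one₀ hρ0.le hρ1.le))).trans_lt hw
      have h2 := (hgδ (by simpa using h1)).le
      rw [Function.iterate_succ_apply', hφg, norm_mul]
      calc _ ≤ (ρ ^ k * ‖w‖) * ρ := mul_le_mul ih h2 (norm_nonneg _) (by positivity)
        _ = _ := by ring
  have hlim : Tendsto (fun N : ℕ => q ^ N * r) atTop (𝓝 0) := by
    simpa using (tendsto_pow_atTop_nhds_zero_of_lt_one (norm_nonneg _) hq1).mul_const r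
  obtain ⟨N₀, hN₀⟩ := (hlim.eventually_lt_const hδ).exists
  -- Past N₀ the rate ρ holds and the factor restores the N₀ missing powers; before N₀ one has ρ^N ≥
  -- ρ^N₀, so the trivial bound r suffices.
  refine ⟨(ρ ^ N₀)⁻¹, by positivity, fun N z hz => ?_⟩
  have hz0 := hstep N₀ z hz
  rcases le_total N₀ N with h | h
  · obtain ⟨k, rfl⟩ := Nat.exists_eq_add_of_le' h
    rw [Function.iterate_add_apply]
    refine (hfast k _ (hz0.1.trans_lt hN₀) hz0.2).trans ?_
    have : (ρ ^ N₀)⁻¹ * ρ ^ (k + N₀) = ρ ^ k := by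
      rw [pow_add]
      field_simp
    rw [this]
    gcongr
    exact hz0.2
  · refine (hstep N z hz).2.trans (le_mul_of_one_le_left hr0 ?_)
    rw [inv_mul_eq_div, one_le_div (by positivity)]
    exact pow_le_pow_of_le_one hρ0.le hρ1.le h

theorem norm_iterate_le_pow {φ : ℂ → ℂ} {κ : ℕ} (hκ : 1 ≤ κ)
    (h : ∀ z ∈ disc, ‖φ z‖ ≤ ‖z‖ ^ κ) {z : ℂ} (hz : z ∈ disc) (N : ℕ) :
    ‖φ^[N] z‖ ≤ ‖z‖ ^ κ ^ N := by
  have hz1 : ‖z‖ < 1 := by simpa using hz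
  induction N with
  | zero => simp
  | succ N ih =>
    have hmem : φ^[N] z ∈ disc := by
      have : ‖z‖ ^ κ ^ N < 1 := pow_lt_one₀ (norm_nonneg _) hz1 (by positivity)
      simpa using ih.trans_lt this
    rw [Function.iterate_succ_apply', pow_succ, pow_mul]
    exact (h _ hmem).trans (pow_le_pow_left₀ (norm_nonneg _) ih κ)

/-! ### Invariance of Lebesgue measure -/

/-- The continuous functions with equal integrals form a closed subspace containing the characters,
whose span is dense. -/
theorem measure_eq_of_integral_fourier_eq {μ ν : Measure Torus} [IsFiniteMeasure μ]
    [IsFiniteMeasure ν] (h : ∀ n : ℤ, ∫ x, fourier n x ∂μ = ∫ x, fourier n x ∂ν) : μ = ν := by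
  have hint : ∀ (μ : Measure Torus) [IsFiniteMeasure μ] (f : C(Torus, ℂ)), Integrable f μ :=
    fun μ _ f => f.continuous.integrable_of_hasCompactSupport (HasCompactSupport.of_compactSpace _)
  have hcont : ∀ (μ : Measure Torus) [IsFiniteMeasure μ],
      Continuous fun f : C(Torus, ℂ) => ∫ x, f x ∂μ := by
    intro μ _
    have := (continuous_integral (μ := μ) (G := ℂ)).comp (ContinuousMap.toLp 1 μ ℂ).continuous
    refine this.congr fun f => ?_
    exact integral_congr_ae (ContinuousMap.coeFn_toLp μ f)
  let W : Submodule ℂ C(Torus, ℂ) :=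
    { carrier := {f | ∫ x, f x ∂μ = ∫ x, f x ∂ν}
      zero_mem' := by simp
      add_mem' := fun {f g} hf hg => by
        simp only [Set.mem_ofPred_eq, ContinuousMap.add_apply] at *
        rw [integral_add (hint μ f) (hint μ g), integral_add (hint ν f) (hint ν g), hf, hg]
      smul_mem' := fun c f hf => by
        simp only [Set.mem_ofPred_eq, ContinuousMap.smul_apply] at *
        rw [integral_smul, integral_smul, hf] }
  have hW : (W : Set C(Torus, ℂ)) = Set.univ := by
    have h1 : Submodule.span ℂ (Set.range (@fourier 1)) ≤ W :=
      Submodule.span_le.2 (by rintro _ ⟨n, rfl⟩; exact h n)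
    have h2 : IsClosed (W : Set C(Torus, ℂ)) := isClosed_eq (hcont μ) (hcont ν)
    have h3 := Submodule.topologicalClosure_minimal _ h1 h2
    rw [span_fourier_closure_eq_top] at h3
    exact congrArg _ (top_le_iff.1 h3)
  refine ext_of_forall_integral_eq_of_IsFiniteMeasure fun f => ?_
  have : (⟨fun x => (f x : ℂ), by fun_prop⟩ : C(Torus, ℂ)) ∈ (W : Set C(Torus, ℂ)) := by
    rw [hW]; trivial
  have h4 : ∫ x, (f x : ℂ) ∂μ = ∫ x, (f x : ℂ) ∂ν := this
  rw [integral_complex_ofReal, integral_complex_ofReal] at h4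
  exact_mod_cast h4

theorem IsInner.integral_boundaryValue_pow {φ : ℂ → ℂ} (hφ : IsInner φ) (h0 : φ 0 = 0) (n : ℕ) :
    ∫ x, boundaryValue φ x ^ n ∂leb = if n = 0 then 1 else 0 := by
  -- With r = 0 the smaller circle degenerates to the centre, where φ(0)^n = 0^n.
  have h := hφ.integral_boundaryValue_pow_mul_eq (r := 0) le_rfl one_pos (g := fun _ => 1)
    (G := fun _ => 1) (integrable_const _) (integrable_const _) (fun n => by
      simp only [mul_one, integral_chi_pow]
      by_cases hn : n = 0 <;> simp [hn]) n
  simp only [mul_one, Complex.ofReal_zero, zero_mul, h0] at h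
  rw [h]
  by_cases hn : n = 0 <;> simp [hn]

theorem IsInner.aemeasurable_restriction {φ : ℂ → ℂ} (hφ : IsInner φ) :
    AEMeasurable (restriction φ) leb := by
  -- A sequence of radii exhibits the boundary function as an almost everywhere limit of continuous
  -- functions.
  obtain ⟨R, -, hR, hRlim⟩ := exists_seq_strictMono_tendsto' (zero_lt_one' ℝ)
  have hbv : AEMeasurable (boundaryValue φ) leb := by
    refine aemeasurable_of_tendsto_metrizable_ae atTop (f := fun n x => φ ((R n : ℂ) * chi x))
      (fun n => (continuous_circle hφ.analytic (hR n).1.le (hR n).2).measurable.aemeasurable) ?_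
    filter_upwards [hφ.hasRadialLimit] with x hx
    exact hx.comp (tendsto_nhdsWithin_iff.2 ⟨hRlim, Eventually.of_forall fun n => (hR n).2⟩)
  have : Measurable fun w : ℂ => ((Complex.arg w / (2 * Real.pi) : ℝ) : Torus) :=
    AddCircle.measurable_mk'.comp (Complex.measurable_arg.div_const _)
  exact this.comp_aemeasurable hbv

/-- The restriction of an inner function fixing `0` agrees almost everywhere with a measure
preserving map. -/
theorem IsInner.exists_measurePreserving {φ : ℂ → ℂ} (hφ : IsInner φ) (h0 : φ 0 = 0) :
    ∃ T : Torus → Torus, MeasurePreserving T leb leb ∧ restriction φ =ᵐ[leb] T ∧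
      ∀ᵐ x ∂leb, chi (T x) = boundaryValue φ x := by
  have hae := hφ.aemeasurable_restriction
  have hT := hae.ae_eq_mk
  have hTm := hae.measurable_mk
  set T := hae.mk (restriction φ)
  have hchi : ∀ᵐ x ∂leb, chi (T x) = boundaryValue φ x := by
    filter_upwards [hφ.radial, hT] with x ⟨w, hw1, hw⟩ hx
    have : boundaryValue φ x = w := hw.limUnder_eq
    rw [← hx, chi_restriction hw1 hw, this]
  refine ⟨T, ⟨hTm, ?_⟩, hT, hchi⟩
  have : IsProbabilityMeasure (leb.map T) := Measure.isProbabilityMeasure_map hTm.aemeasurable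
  have hnat : ∀ n : ℕ, ∫ x, fourier (n : ℤ) x ∂(leb.map T) = ∫ x, fourier (n : ℤ) x ∂leb := by
    intro n
    rw [integral_map hTm.aemeasurable (map_continuous _).aestronglyMeasurable]
    simp_rw [← chi_pow]
    rw [integral_chi_pow, ← hφ.integral_boundaryValue_pow h0]
    refine integral_congr_ae ?_
    filter_upwards [hchi] with x hx
    rw [hx]
  refine measure_eq_of_integral_fourier_eq fun n => ?_
  obtain ⟨k, rfl | rfl⟩ := n.eq_nat_or_neg
  · exact hnat k
  · simp_rw [fourier_neg]
    rw [integral_conj, integral_conj, hnat]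

/-! ### The transfer operator as an adjoint -/

section Koopman

variable {X : Type*} [MeasurableSpace X] {μ : Measure X}

/-- The adjoint of the Koopman operator of a measure preserving map. -/
def koopmanAdjoint {T : X → X} (hT : MeasurePreserving T μ μ) : Lp ℂ 2 μ →L[ℂ] Lp ℂ 2 μ :=
  ContinuousLinearMap.adjoint (Lp.compMeasurePreservingₗᵢ ℂ T hT).toContinuousLinearMap

theorem integral_mul_koopmanAdjoint {T : X → X} (hT : MeasurePreserving T μ μ) (w : Lp ℂ 2 μ)
    {ψ : X → ℂ} (hψ : MemLp ψ 2 μ) :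
    ∫ x, ψ x * koopmanAdjoint hT w x ∂μ = ∫ x, ψ (T x) * w x ∂μ := by
  have hψ' : MemLp (fun x => starRingEnd ℂ (ψ x)) 2 μ := hψ.star
  have h := ContinuousLinearMap.adjoint_inner_right
    (Lp.compMeasurePreservingₗᵢ ℂ T hT).toContinuousLinearMap (hψ'.toLp) w
  rw [L2.inner_def, L2.inner_def] at h
  have e1 : ∫ x, ψ x * koopmanAdjoint hT w x ∂μ =
      ∫ x, inner ℂ (hψ'.toLp _ x) (koopmanAdjoint hT w x) ∂μ := by
    refine integral_congr_ae ?_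
    filter_upwards [hψ'.coeFn_toLp] with x hx
    rw [hx]
    simp [mul_comm]
  rw [e1]
  refine Eq.trans h (integral_congr_ae ?_)
  have h3 : ((Lp.compMeasurePreservingₗᵢ ℂ T hT).toContinuousLinearMap hψ'.toLp : Lp ℂ 2 μ) =ᵐ[μ]
      hψ'.toLp ∘ T := Lp.coeFn_compMeasurePreserving _ hT
  filter_upwards [h3, hT.quasiMeasurePreserving.ae hψ'.coeFn_toLp] with x hx hx2
  rw [hx, Function.comp_apply, hx2]
  simp [mul_comm]

theorem integral_mul_conj_koopmanAdjoint {T : X → X} (hT : MeasurePreserving T μ μ) (w : Lp ℂ 2 μ)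
    {ψ : X → ℂ} (hψ : MemLp ψ 2 μ) :
    ∫ x, ψ x * starRingEnd ℂ (koopmanAdjoint hT w x) ∂μ =
      ∫ x, ψ (T x) * starRingEnd ℂ (w x) ∂μ := by
  have h := congrArg (starRingEnd ℂ) (integral_mul_koopmanAdjoint hT w hψ.star)
  rw [← integral_conj, ← integral_conj] at h
  simpa using h

/-- On square integrable functions, the transfer operator is the adjoint of the Koopman operator. -/
theorem transferOp_ae_eq [IsProbabilityMeasure μ] {T T' : X → X} (hT' : MeasurePreserving T' μ μ)
    (hT : T =ᵐ[μ] T') {f : Lp ℂ 1 μ} {w : Lp ℂ 2 μ} {c : ℂ} (hf : f =ᵐ[μ] fun x => w x + c) :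
    transferOp μ T f =ᵐ[μ] fun x => koopmanAdjoint hT' w x + c := by
  have hwi : Integrable w μ := (Lp.memLp w).integrable (by norm_num)
  have hki : Integrable (koopmanAdjoint hT' w) μ := (Lp.memLp _).integrable (by norm_num)
  have hg : Integrable (fun x => koopmanAdjoint hT' w x + c) μ := hki.add (integrable_const c)
  have hspec : ∀ A : Set X, MeasurableSet A →
      ∫ x in A, hg.toL1 _ x ∂μ = ∫ x in T ⁻¹' A, f x ∂μ := by
    intro A hA
    have hA' := hT'.measurable hA
    have hpre : (T ⁻¹' A : Set X) =ᵐ[μ] (T' ⁻¹' A : Set X) := by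
      filter_upwards [hT] with x hx
      exact congrArg (fun y => A y) hx
    rw [setIntegral_congr_set hpre, setIntegral_congr_ae hA (hg.coeFn_toL1.mono fun x hx _ => hx),
      setIntegral_congr_ae hA' (hf.mono fun x hx _ => hx),
      integral_add hki.integrableOn (integrable_const c).integrableOn,
      integral_add hwi.integrableOn (integrable_const c).integrableOn]
    congr 1
    · have hind : MemLp (A.indicator fun _ => (1 : ℂ)) 2 μ := (memLp_const 1).indicator hA
      have h := integral_mul_koopmanAdjoint hT' w hind
      rw [← integral_indicator hA, ← integral_indicator hA']
      convert! h using 2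
      · funext x
        by_cases hx : x ∈ A <;> simp [hx]
      · funext x
        by_cases hx : T' x ∈ A <;> simp [hx]
    · simp [Measure.real, hT'.measure_preimage hA.nullMeasurableSet]
  -- `transferOp` is only a choice; the candidate built from the adjoint shows that a solution
  -- exists, and its integrals over measurable sets determine it almost everywhere.
  have huniq := Classical.epsilon_spec (p := fun g : Lp ℂ 1 μ =>
    ∀ A : Set X, MeasurableSet A → ∫ x in A, g x ∂μ = ∫ x in T ⁻¹' A, f x ∂μ) ⟨_, hspec⟩
  have heq : transferOp μ T f =ᵐ[μ] hg.toL1 _ :=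
    Integrable.ae_eq_of_forall_setIntegral_eq _ _ (L1.integrable_coeFn _) (L1.integrable_coeFn _)
      fun A hA _ => (huniq A hA).trans (hspec A hA).symm
  exact heq.trans hg.coeFn_toL1

theorem iterate_transferOp_ae_eq [IsProbabilityMeasure μ] {T T' : X → X}
    (hT' : MeasurePreserving T' μ μ) (hT : T =ᵐ[μ] T') {f : Lp ℂ 1 μ} {w : Lp ℂ 2 μ} {c : ℂ}
    (hf : f =ᵐ[μ] fun x => w x + c) (N : ℕ) :
    ((transferOp μ T)^[N] f : Lp ℂ 1 μ) =ᵐ[μ] fun x => (koopmanAdjoint hT')^[N] w x + c := by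
  induction N with
  | zero => exact hf
  | succ N ih =>
    rw [Function.iterate_succ_apply', Function.iterate_succ_apply']
    exact transferOp_ae_eq hT' hT ih

end Koopman

/-! ### Joining the two halves of the Fourier series -/

/-- The two half-sums over ℕ both count index 0, which is harmless because p and q vanish there. -/
theorem summable_and_tsum_int_le {p q : ℤ → ℝ} {C : ℝ} (hq0 : q 0 = 0) (hp0 : p 0 = 0)
    (hq : Summable q) (h1 : Summable fun n : ℕ => p n) (h2 : Summable fun n : ℕ => p (-n))
    (hle1 : ∑' n : ℕ, p n ≤ C * ∑' n : ℕ, q n) (hle2 : ∑' n : ℕ, p (-n) ≤ C * ∑' n : ℕ, q (-n)) :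
    Summable p ∧ ∑' n, p n ≤ C * ∑' n, q n := by
  have hinj : Function.Injective fun n : ℕ => -(n : ℤ) := fun i j h => by simpa using h
  have hqs := HasSum.of_nat_of_neg (hq.comp_injective Nat.cast_injective).hasSum
    (hq.comp_injective hinj).hasSum
  have hps := HasSum.of_nat_of_neg h1.hasSum h2.hasSum
  refine ⟨hps.summable, ?_⟩
  rw [hps.tsum_eq, hqs.tsum_eq, hq0, hp0, sub_zero, sub_zero, mul_add]
  exact add_le_add hle1 hle2

theorem expSpace_congr_ae {b : ℝ} {u v : Torus → ℂ} (h : u =ᵐ[leb] v) (hv : v ∈ expSpace b) :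
    u ∈ expSpace b := by
  refine ⟨hv.1.ae_eq h.symm, ?_⟩
  rw [fourierCoeff_congr_ae h]
  exact hv.2

theorem expNorm_congr_ae (b : ℝ) {u v : Torus → ℂ} (h : u =ᵐ[leb] v) :
    expNorm b u = expNorm b v := by
  rw [expNorm, expNorm, fourierCoeff_congr_ae h]

theorem fourierCoeff_sub_integral {u : Torus → ℂ} (hu : Integrable u leb) (n : ℤ) :
    fourierCoeff (fun x => u x - ∫ t, u t ∂leb) n = if n = 0 then 0 else fourierCoeff u n := by
  have h1 : (fun x => u x - ∫ t, u t ∂leb) =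
      u + fun x => -(∫ t, u t ∂leb) * fourier (T := 1) 0 x := by
    funext x
    simp [sub_eq_add_neg]
  rw [h1, fourierCoeff.add hu (by simp), Pi.add_apply, fourierCoeff.const_mul]
  erw [fourierCoeff_fourier 0]
  by_cases hn : n = 0
  · subst hn
    simp [fourierCoeff]
  · simp [hn]

theorem integral_chi_pow_mul_conj (n : ℕ) (G : Torus → ℂ) :
    ∫ x, chi x ^ n * starRingEnd ℂ (G x) ∂leb = starRingEnd ℂ (fourierCoeff G n) := by
  rw [fourierCoeff, ← integral_conj]
  simp [chi_pow, -fourier_apply, fourier_neg]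

theorem memLp_chi_pow (n : ℕ) : MemLp (fun x => chi x ^ n) 2 leb :=
  (continuous_chi.pow n).memLp_of_hasCompactSupport (HasCompactSupport.of_compactSpace _)

/-- The spectral bound in terms of the size of the iterates on the circle of radius `b^(-1/2)`. -/
theorem IsInner.deviation_mem_and_expNorm_le {φ : ℂ → ℂ} (hφ : IsInner φ) (h0 : φ 0 = 0) {b : ℝ}
    (hb : 1 < b) {u : Lp ℂ 1 leb} (hu : (u : Torus → ℂ) ∈ expSpace b) (N : ℕ) {s : ℝ}
    (hs0 : 0 ≤ s) (hs : ∀ z : ℂ, ‖z‖ ≤ (Real.sqrt b)⁻¹ → ‖φ^[N] z‖ ≤ s) (hsb : s ^ 2 * b ≤ 1) :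
    deviation φ N u ∈ expSpace b ∧
      expNorm b (deviation φ N u) ≤ s * Real.sqrt b * expNorm b u := by
  have hb0 : 0 < b := by linarith
  obtain ⟨T, hT, hTae, hTchi⟩ := hφ.exists_measurePreserving h0
  have hui : Integrable u leb := L1.integrable_coeFn u
  set c := ∫ t, u t ∂leb with hc
  have hv : MemLp (fun x => u x - c) 2 leb := hu.1.sub (memLp_const c)
  set w : ℕ → Lp ℂ 2 leb := fun N => (koopmanAdjoint hT)^[N] hv.toLp with hw
  have hwsucc : ∀ N, w (N + 1) = koopmanAdjoint hT (w N) := fun N =>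
    Function.iterate_succ_apply' _ _ _
  have hw0 : w 0 =ᵐ[leb] fun x => u x - c := hv.coeFn_toLp
  have hdev : deviation φ N u =ᵐ[leb] w N := by
    have h := iterate_transferOp_ae_eq hT hTae (f := u) (w := hv.toLp) (c := c)
      (by filter_upwards [hv.coeFn_toLp] with x hx; rw [hx]; ring) N
    filter_upwards [h] with x hx
    rw [deviation, hx]
    simp [hw, hc]
  have hwL : ∀ N, MemLp (w N) 2 leb := fun N => Lp.memLp _
  have hstep : ∀ N n : ℕ, ∫ x, chi x ^ n * w (N + 1) x ∂leb =
      ∫ x, boundaryValue φ x ^ n * w N x ∂leb := fun N n => by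
    rw [hwsucc, integral_mul_koopmanAdjoint hT _ (memLp_chi_pow n)]
    refine integral_congr_ae ?_
    filter_upwards [hTchi] with x hx
    rw [hx]
  have hstep' : ∀ N n : ℕ, ∫ x, chi x ^ n * starRingEnd ℂ (w (N + 1) x) ∂leb =
      ∫ x, boundaryValue φ x ^ n * starRingEnd ℂ (w N x) ∂leb := fun N n => by
    rw [hwsucc, integral_mul_conj_koopmanAdjoint hT _ (memLp_chi_pow n)]
    refine integral_congr_ae ?_
    filter_upwards [hTchi] with x hx
    rw [hx]
  have hcoeff : ∀ n, fourierCoeff (w 0) n = if n = 0 then 0 else fourierCoeff u n := fun n => by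
    rw [fourierCoeff_congr_ae hw0, fourierCoeff_sub_integral hui]
  have hmean : ∀ N, ∫ x, w N x ∂leb = 0 := by
    intro N
    induction N with
    | zero => simpa [fourierCoeff] using hcoeff 0
    | succ N ih => simpa [ih] using hstep N 0
  have hmean' : ∀ N, ∫ x, starRingEnd ℂ (w N x) ∂leb = 0 := fun N => by
    rw [integral_conj, hmean, map_zero]
  have hcoeff0 : ∀ N, fourierCoeff (w N) 0 = 0 := fun N => by simpa [fourierCoeff] using hmean N
  have hle : ∀ n : ℤ, b ^ n.natAbs * ‖fourierCoeff (w 0) n‖ ^ 2 ≤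
      b ^ n.natAbs * ‖fourierCoeff u n‖ ^ 2 := fun n => by
    rw [hcoeff]
    by_cases hn : n = 0
    · simp [hn]
    · simp [hn]
  have hsum0 : Summable fun n : ℤ => b ^ n.natAbs * ‖fourierCoeff (w 0) n‖ ^ 2 :=
    Summable.of_nonneg_of_le (fun _ => by positivity) hle hu.2
  have hinj : Function.Injective fun n : ℕ => -(n : ℤ) := fun i j h => by simpa using h
  have hneg := hφ.summable_and_tsum_moments_le h0 hb hwL hmean hstep
    (by simpa [integral_chi_pow_mul, Function.comp_def] using hsum0.comp_injective hinj) N hs hsb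
  -- Moments see only the coefficients at -n. Those at n are reached through the conjugate of w,
  -- which obeys the same recursion.
  have hpos := hφ.summable_and_tsum_moments_le h0 hb (fun N => (hwL N).star) hmean' hstep'
    (by
      simpa [integral_chi_pow_mul_conj, Function.comp_def] using
        hsum0.comp_injective Nat.cast_injective) N hs hsb
  simp only [integral_chi_pow_mul] at hneg
  simp only [Pi.star_apply, RCLike.star_def, integral_chi_pow_mul_conj, RCLike.norm_conj] at hpos
  obtain ⟨hsN, hleN⟩ := summable_and_tsum_int_le (C := s ^ 2 * b)
    (p := fun n : ℤ => b ^ n.natAbs * ‖fourierCoeff (w N) n‖ ^ 2)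
    (by simp [hcoeff0]) (by simp [hcoeff0]) hsum0 (by simpa using hpos.1) (by simpa using hneg.1)
    (by simpa using hpos.2) (by simpa using hneg.2)
  refine ⟨expSpace_congr_ae hdev ⟨hwL N, hsN⟩, ?_⟩
  rw [expNorm_congr_ae b hdev, expNorm, expNorm]
  have hC : s * Real.sqrt b = Real.sqrt (s ^ 2 * b) := by
    rw [Real.sqrt_mul (by positivity), Real.sqrt_sq hs0]
  rw [hC, ← Real.sqrt_mul (by positivity)]
  refine Real.sqrt_le_sqrt (hleN.trans ?_)
  exact mul_le_mul_of_nonneg_left (hsum0.tsum_le_tsum hle hu.2) (by positivity)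

end InnerFunction

end

/-! ### The two spectral bounds -/

theorem mainTheorem2 (φ : ℂ → ℂ) (hφ : InnerFunction.IsInner φ)
    (hmob : ¬ InnerFunction.IsMobius φ) (h0 : φ 0 = 0) :
    (∀ b : ℝ, 1 < b → ∀ ρ : ℝ, ‖deriv φ 0‖ < ρ → ρ < 1 →
      ∃ M : ℝ, 0 < M ∧
        ∀ u : Lp ℂ 1 InnerFunction.leb, (u : InnerFunction.Torus → ℂ) ∈ InnerFunction.expSpace b →
          ∀ N : ℕ,
            InnerFunction.deviation φ N u ∈ InnerFunction.expSpace b ∧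
            InnerFunction.expNorm b (InnerFunction.deviation φ N u)
              ≤ M * ρ ^ N * InnerFunction.expNorm b u) ∧
    (∀ (κ : ℕ) (Φ : ℂ → ℂ), 1 ≤ κ →
      (InnerFunction.IsInner Φ ∨
        ∃ c : ℂ, ‖c‖ = 1 ∧ ∀ z ∈ InnerFunction.disc, Φ z = c) →
      (∀ z ∈ InnerFunction.disc, φ z = z ^ κ * Φ z) →
      ∀ b : ℝ, 1 < b →
        ∀ u : Lp ℂ 1 InnerFunction.leb, (u : InnerFunction.Torus → ℂ) ∈ InnerFunction.expSpace b →
          ∀ N : ℕ,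
            InnerFunction.deviation φ N u ∈ InnerFunction.expSpace b ∧
            InnerFunction.expNorm b (InnerFunction.deviation φ N u)
              ≤ b / Real.sqrt (b - 1) * (1 / b ^ ((κ : ℝ) ^ N / 2)) *
                InnerFunction.expNorm b u) := by
  have hdisc : ∀ {b : ℝ}, 1 < b → ∀ {z : ℂ}, ‖z‖ ≤ (Real.sqrt b)⁻¹ → z ∈ InnerFunction.disc :=
    fun hb z hz => mem_ball_zero_iff.2 (hz.trans_lt (inv_lt_one_of_one_lt₀
      (by rw [Real.lt_sqrt zero_le_one]; simpa using hb)))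
  refine ⟨fun b hb ρ hρ hρ1 => ?_, fun κ Φ hκ hΦ hfac b hb u hu N => ?_⟩
  · have hb0 : 0 < b := by linarith
    have hsb0 : 0 < Real.sqrt b := Real.sqrt_pos.2 hb0
    have hρ0 : 0 < ρ := (norm_nonneg _).trans_lt hρ
    have hr : (Real.sqrt b)⁻¹ < 1 :=
      inv_lt_one_of_one_lt₀ (by rw [Real.lt_sqrt zero_le_one]; simpa using hb)
    obtain ⟨C, hC, hbound⟩ := hφ.exists_norm_iterate_le hmob h0 hρ hρ1 (by positivity) hr
    refine ⟨C, hC, fun u hu N => ?_⟩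
    -- For small N the bound C ρ^N r may exceed r, violating s² b ≤ 1; the minimum with the Schwarz
    -- bound r repairs this.
    set s := min (C * ρ ^ N * (Real.sqrt b)⁻¹) (Real.sqrt b)⁻¹ with hs
    have hs0 : 0 ≤ s := by positivity
    -- The case κ = 1 of the power bound is Schwarz's lemma iterated.
    have hid : ∀ z : ℂ, ‖z‖ ≤ (Real.sqrt b)⁻¹ → ‖φ^[N] z‖ ≤ (Real.sqrt b)⁻¹ := fun z hz => by
      have := InnerFunction.norm_iterate_le_pow (φ := φ) le_rfl
        (fun z hz => by simpa using hφ.norm_le h0 hz) (hdisc hb hz) N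
      simpa using this.trans (by simpa using hz)
    have hsb : s ^ 2 * b ≤ 1 := by
      calc s ^ 2 * b ≤ (Real.sqrt b)⁻¹ ^ 2 * b := by
            gcongr
            exact min_le_right _ _
        _ = 1 := by rw [inv_pow, Real.sq_sqrt hb0.le, inv_mul_cancel₀ hb0.ne']
    obtain ⟨h1, h2⟩ := hφ.deviation_mem_and_expNorm_le h0 hb hu N hs0
      (fun z hz => le_min (hbound N z hz) (hid z hz)) hsb
    refine ⟨h1, h2.trans (mul_le_mul_of_nonneg_right ?_ (Real.sqrt_nonneg _))⟩
    calc s * Real.sqrt b ≤ C * ρ ^ N * (Real.sqrt b)⁻¹ * Real.sqrt b := by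
          gcongr
          exact min_le_left _ _
      _ = C * ρ ^ N := by rw [mul_assoc, inv_mul_cancel₀ hsb0.ne', mul_one]
  · have hb0 : 0 < b := by linarith
    have hsb0 : 0 < Real.sqrt b := Real.sqrt_pos.2 hb0
    have hr : (Real.sqrt b)⁻¹ < 1 :=
      inv_lt_one_of_one_lt₀ (by rw [Real.lt_sqrt zero_le_one]; simpa using hb)
    have hΦ1 : ∀ z ∈ InnerFunction.disc, ‖Φ z‖ ≤ 1 := by
      rcases hΦ with hΦ | ⟨c, hc, hΦ⟩
      · exact fun z hz => (mem_ball_zero_iff.1 (hΦ.mapsTo hz)).le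
      · exact fun z hz => by rw [hΦ z hz, hc]
    have hpow : ∀ z ∈ InnerFunction.disc, ‖φ z‖ ≤ ‖z‖ ^ κ := fun z hz => by
      rw [hfac z hz, norm_mul, norm_pow]
      exact mul_le_of_le_one_right (by positivity) (hΦ1 z hz)
    have hκN : 1 ≤ κ ^ N := Nat.one_le_pow _ _ hκ
    have hsb : ((Real.sqrt b)⁻¹ ^ κ ^ N) ^ 2 * b ≤ 1 := by
      calc ((Real.sqrt b)⁻¹ ^ κ ^ N) ^ 2 * b ≤ (Real.sqrt b)⁻¹ ^ 2 * b := by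
            gcongr
            exact pow_le_of_le_one (by positivity) hr.le (by omega)
        _ = 1 := by rw [inv_pow, Real.sq_sqrt hb0.le, inv_mul_cancel₀ hb0.ne']
    obtain ⟨h1, h2⟩ := hφ.deviation_mem_and_expNorm_le h0 hb hu N
      (s := (Real.sqrt b)⁻¹ ^ κ ^ N) (by positivity)
      (fun z hz => (InnerFunction.norm_iterate_le_pow hκ hpow (hdisc hb hz) N).trans
        (pow_le_pow_left₀ (norm_nonneg _) hz _)) hsb
    refine ⟨h1, h2.trans (mul_le_mul_of_nonneg_right ?_ (Real.sqrt_nonneg _))⟩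
    have hexp : b ^ ((κ : ℝ) ^ N / 2) = Real.sqrt b ^ κ ^ N := by
      rw [Real.sqrt_eq_rpow, ← Real.rpow_natCast (b ^ (1 / 2 : ℝ)), ← Real.rpow_mul hb0.le]
      congr 1
      push_cast
      ring
    rw [hexp, inv_pow, mul_comm, ← one_div]
    refine mul_le_mul_of_nonneg_right ?_ (by positivity)
    -- The argument gives the constant √b, which is at most b/√(b-1) because √(b-1) ≤ √b.
    rw [le_div_iff₀ (Real.sqrt_pos.2 (by linarith))]
    calc Real.sqrt b * Real.sqrt (b - 1) ≤ Real.sqrt b * Real.sqrt b := by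
          gcongr
          linarith
      _ = b := Real.mul_self_sqrt hb0.le
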